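/- Let $\mathrm{L}(\mathbb{C}^d)$ denote the complex $d\times d$ matrices, and let $\log$ be the natural logarithm. A *quantum channel* $\Phi:\mathrm{L}(\mathcal X_A)\to \mathrm{L}(\mathcal X_B)$ is a completely positive trace-preserving linear map. For positive semidefinite $\rho,\sigma$ put $H(\rho)=-\mathrm{Tr}\,\rho\log\rho$ (with $0\log 0=0$), and $D(\rho\|\sigma)=\mathrm{Tr}\,\rho(\log\rho-\log\sigma)$ if $\mathrm{supp}(\rho)\subseteq\mathrm{supp}(\sigma)$ and $D(\rho\|\sigma)=\infty$ otherwise. For channels $\Phi,\Psi:\mathrm{L}(\mathcal X_A)\to \mathrm{L}(\mathcal X_B)$ let $$D(\Phi\|\Psi)=\sup_{\rho_{AR}} D\big((\Phi\otimes 1)(\rho_{AR})\,\big\|\,(\Psi\otimes 1)(\rho_{AR})\big),$$ the supremum being over all finite-dimensional reference spaces $\mathcal X_R$ and all density operators $\rho_{AR}$ on $\mathcal X_A\otimes\mathcal X_R$. The entropy of a channel is $$H(\Phi)=\log\dim\mathcal X_B-D(\Phi\|\mathcal R),\qquad \mathcal R(\rho)=(\mathrm{Tr}\,\rho)\,1/\dim\mathcal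 X_B,$$ and its map entropy is $H^K(\Phi)=H(J_\Phi)$, where $J_\Phi=\frac1d(\Phi\otimes 1)(|\phi^+\rangle\langle\phi^+|)$ with $|\phi^+\rangle=\sum_{i=1}^d|ii\rangle$ and $d=\dim\mathcal X_A$. **Theorem.** Let $\Phi:\mathrm{L}(\mathbb{C}^2)\to \mathrm{L}(\mathbb{C}^2)$ be a quantum channel with $\Phi(1)=1$. Then $$H(\Phi)=H^K(\Phi)-\log 2.$$ Moreover, the supremum defining $D(\Phi\|\mathcal R)$ is attained at the maximally entangled state $\rho_{AR}=\frac12|\phi^+\rangle\langle\phi^+|$ on $\mathbb{C}^2\otimes\mathbb{C}^2$. -/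

import Mathlib

namespace QChannel

open Matrix
open scoped ComplexOrder

variable {a b : Type*} [Fintype a] [DecidableEq a] [Fintype b] [DecidableEq b]

/-- Density operators: positive semidefinite (in particular Hermitian) matrices of trace one. -/
structure IsDensity (ρ : Matrix a a ℂ) : Prop where
  posSemidef : ρ.PosSemidef
  trace_eq_one : ρ.trace = 1

/-- The extended map `Φ ⊗ 1` on `L(X_A ⊗ X_R)`: `Φ` is applied to each block
`(⟨k s| ρ |l t⟩)_{k l}` for basis indices `s`, `t` of the reference space. -/
def extend (r : Type*) (Φ : Matrix a a ℂ →ₗ[ℂ] Matrix b b ℂ) (ρ : Matrix (a × r) (a × r) ℂ) :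
    Matrix (b × r) (b × r) ℂ :=
  Matrix.of fun x y => Φ (Matrix.of fun k l => ρ (k, x.2) (l, y.2)) x.1 y.1

/-- Quantum channels: completely positive trace-preserving linear maps. -/
structure IsChannel (Φ : Matrix a a ℂ →ₗ[ℂ] Matrix b b ℂ) : Prop where
  completely_positive : ∀ (n : ℕ) (ρ : Matrix (a × Fin n) (a × Fin n) ℂ),
    ρ.PosSemidef → (extend (Fin n) Φ ρ).PosSemidef
  trace_preserving : ∀ ρ : Matrix a a ℂ, (Φ ρ).trace = ρ.trace

/-- The matrix logarithm (natural logarithm of a Hermitian matrix, by functional calculus).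
As `Real.log 0 = 0`, it is the logarithm on the support and zero on the kernel. -/
noncomputable def matLog (ρ : Matrix a a ℂ) : Matrix a a ℂ := cfc Real.log ρ

/-- The von Neumann entropy `H(ρ) = - Tr ρ log ρ` (with `0 log 0 = 0`). -/
noncomputable def vonNeumannEntropy (ρ : Matrix a a ℂ) : ℝ := -((ρ * matLog ρ).trace).re

open Classical in
/-- The relative entropy `D(ρ ‖ σ) = Tr ρ (log ρ - log σ)` of positive semidefinite matrices,
equal to `∞` unless `supp ρ ⊆ supp σ`. The support is the orthogonal complement of the kernel,
so the inclusion says `ker σ ⊆ ker ρ`. -/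
noncomputable def relEntropy (ρ σ : Matrix a a ℂ) : EReal :=
  if ∀ v : a → ℂ, σ *ᵥ v = 0 → ρ *ᵥ v = 0 then
    (((ρ * (matLog ρ - matLog σ)).trace.re : ℝ) : EReal)
  else ⊤

/-- The relative entropy of channels `D(Φ ‖ Ψ)`: the supremum of
`D((Φ ⊗ 1)(ρ_AR) ‖ (Ψ ⊗ 1)(ρ_AR))` over all finite-dimensional reference spaces `X_R = ℂⁿ` and
all (pure or mixed) states `ρ_AR` on `X_A ⊗ X_R`. -/
noncomputable def channelRelEntropy (Φ Ψ : Matrix a a ℂ →ₗ[ℂ] Matrix b b ℂ) : EReal :=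
  ⨆ (n : ℕ) (ρ : Matrix (a × Fin n) (a × Fin n) ℂ) (_ : IsDensity ρ),
    relEntropy (extend (Fin n) Φ ρ) (extend (Fin n) Ψ ρ)

/-- The depolarizing channel `R : ρ ↦ (Tr ρ) 1 / dim X_B`. -/
noncomputable def depolarizing (a b : Type*) [Fintype a] [Fintype b] [DecidableEq b] :
    Matrix a a ℂ →ₗ[ℂ] Matrix b b ℂ :=
  (Matrix.traceLinearMap a ℂ ℂ).smulRight ((Fintype.card b : ℂ)⁻¹ • (1 : Matrix b b ℂ))

/-- The entropy of a channel, `H(Φ) = log dim X_B - D(Φ ‖ R)`. -/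
noncomputable def channelEntropy (Φ : Matrix a a ℂ →ₗ[ℂ] Matrix b b ℂ) : EReal :=
  ((Real.log (Fintype.card b) : ℝ) : EReal) - channelRelEntropy Φ (depolarizing a b)

/-- The vector `|φ⁺⟩ = ∑ᵢ |i i⟩`. -/
def phiPlus (a : Type*) [DecidableEq a] : a × a → ℂ := fun x => if x.1 = x.2 then 1 else 0

/-- The Choi matrix `D_Φ = (Φ ⊗ 1)(|φ⁺⟩⟨φ⁺|)`. -/
def choi (Φ : Matrix a a ℂ →ₗ[ℂ] Matrix b b ℂ) : Matrix (b × a) (b × a) ℂ :=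
  extend a Φ (Matrix.vecMulVec (phiPlus a) (star (phiPlus a)))

/-- The Choi-Jamiołkowski state `J_Φ = D_Φ / dim X_A`. -/
noncomputable def choiState (Φ : Matrix a a ℂ →ₗ[ℂ] Matrix b b ℂ) : Matrix (b × a) (b × a) ℂ :=
  (Fintype.card a : ℂ)⁻¹ • choi Φ

/-- The map entropy `H^K(Φ) = H(J_Φ)`. -/
noncomputable def mapEntropy (Φ : Matrix a a ℂ →ₗ[ℂ] Matrix b b ℂ) : ℝ :=
  vonNeumannEntropy (choiState Φ)

/-- The maximally entangled state `|φ⁺⟩⟨φ⁺| / dim X_A` on `X_A ⊗ X_A`. -/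
noncomputable def maxEntangled (a : Type*) [Fintype a] [DecidableEq a] :
    Matrix (a × a) (a × a) ℂ :=
  (Fintype.card a : ℂ)⁻¹ • Matrix.vecMulVec (phiPlus a) (star (phiPlus a))

end QChannel

/-! A unital qubit channel is a mixture, with weights `p i`, of four Hilbert-Schmidt orthogonal
unitaries (`exists_choi_eq`), and the uniform mixture of the same unitaries is `depolarizing`. On
any input, the two outputs are therefore mixtures of the same four states, with weights `p i` and
`1/4`. Monotonicity of relative entropy under preparation of states (`relEntropy_sum_smul_le`)
bounds their divergence by the classical one, `∑ p i log (4 p i) = 2 log 2 - H(p)`. On the maximally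
entangled input the four states are orthogonal, so `p` is the spectrum of the Choi state and the
bound is attained.

Monotonicity is proved through resolvents of the relative modular operator: a variational formula
and the Schwarz inequality compare them at each `t ≥ 0`, and integration over `t` yields logarithms.
The unitaries come from the quaternion basis, where the Choi matrix is real symmetric, hence
diagonalized by a real orthogonal matrix. -/

namespace QChannel

open Matrix
open scoped ComplexOrder

variable {a b : Type*} [Fintype a] [DecidableEq a] [Fintype b]

/-! ### Monotonicity of relative entropy under preparation of states -/

/-- A positive semidefinite matrix and its logarithm are diagonalized by the same unitary. -/
theorem exists_diagonalization {ρ : Matrix a a ℂ} (hρ : ρ.PosSemidef) :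
    ∃ (U : Matrix a a ℂ) (l : a → ℝ), Uᴴ * U = 1 ∧ U * Uᴴ = 1 ∧ (∀ i, 0 ≤ l i) ∧
      ρ = U * diagonal (fun i => (l i : ℂ)) * Uᴴ ∧
      matLog ρ = U * diagonal (fun i => (Real.log (l i) : ℂ)) * Uᴴ := by
  refine ⟨hρ.1.eigenvectorUnitary, hρ.1.eigenvalues, ?_, ?_, hρ.eigenvalues_nonneg, ?_, ?_⟩
  · rw [← star_eq_conjTranspose]; exact Unitary.coe_star_mul_self _
  · rw [← star_eq_conjTranspose]; exact Unitary.coe_mul_star_self _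
  · conv_lhs => rw [hρ.1.spectral_theorem, Unitary.conjStarAlgAut_apply]
    rfl
  · rw [matLog, hρ.1.cfc_eq, IsHermitian.cfc, Unitary.conjStarAlgAut_apply]
    rfl

/-- Nonnegativity of the variance of `Z` in the state `τ`, obtained by expanding `Tr (Z - z) τ (Z -
z)ᴴ ≥ 0`. -/
theorem IsDensity.normSq_trace_mul_le {τ : Matrix a a ℂ} (hτ : IsDensity τ) (Z : Matrix a a ℂ) :
    Complex.normSq (τ * Z).trace ≤ (τ * (Zᴴ * Z)).trace.re := by
  set z := (τ * Z).trace with hz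
  have h := (hτ.posSemidef.mul_mul_conjTranspose_same (Z - z • 1)).trace_nonneg
  have h1 : (τ * Zᴴ).trace = star z := by
    rw [hz, ← trace_conjTranspose, conjTranspose_mul, hτ.posSemidef.1.eq, trace_mul_comm]
  have h2 : ((Z - z • 1) * τ * (Z - z • 1)ᴴ).trace
      = (τ * (Zᴴ * Z)).trace - star z * z := by
    rw [Matrix.mul_assoc, trace_mul_comm]
    simp only [conjTranspose_sub, conjTranspose_smul, conjTranspose_one, Matrix.mul_sub,
      Matrix.sub_mul, Matrix.mul_smul, Matrix.smul_mul, Matrix.mul_one, trace_sub,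
      trace_smul, smul_eq_mul, h1, ← hz, hτ.trace_eq_one, Matrix.mul_assoc]
    ring
  rw [h2] at h
  have h3 := (Complex.le_def.1 h).1
  simp only [Complex.sub_re, Complex.zero_re, Complex.star_def, ← Complex.normSq_eq_conj_mul_self,
    Complex.ofReal_re] at h3
  linarith

theorem trace_diagonal_mul_mul_conjTranspose (d : a → ℂ) (A B : Matrix a b ℂ) :
    (diagonal d * A * Bᴴ).trace = ∑ j, ∑ k, d j * A j k * star (B j k) := by
  simp only [trace, diag_apply, mul_apply (M := diagonal d * A), diagonal_mul,
    conjTranspose_apply]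

theorem trace_diagonal_mul_conjTranspose_mul {c : Type*} [Fintype c] [DecidableEq b]
    (d : b → ℂ) (A B : Matrix c b ℂ) :
    (diagonal d * (Bᴴ * A)).trace = ∑ j, ∑ k, d k * A j k * star (B j k) := by
  rw [Finset.sum_comm]
  simp only [trace, diag_apply, diagonal_mul, mul_apply (M := Bᴴ), conjTranspose_apply,
    Finset.mul_sum]
  refine Finset.sum_congr rfl fun _ _ => Finset.sum_congr rfl fun _ _ => ?_
  ring

/-- The bound on the resolvents of the relative modular operator which, integrated over `t`,
yields the monotonicity of the relative entropy under the preparation of the states `τ i`. -/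
theorem sum_resolvent_le {ι : Type*} [Fintype ι] {τ : ι → Matrix a a ℂ}
    (hτ : ∀ i, IsDensity (τ i)) {p q : ι → ℝ} (hp : ∀ i, 0 ≤ p i) (hq : ∀ i, 0 < q i)
    {U V : Matrix a a ℂ} {l m : a → ℝ} (hU : Uᴴ * U = 1) (hV : Vᴴ * V = 1)
    (hρ : ∑ i, (p i : ℂ) • τ i = U * diagonal (fun i => (l i : ℂ)) * Uᴴ)
    (hσ : ∑ i, (q i : ℂ) • τ i = V * diagonal (fun i => (m i : ℂ)) * Vᴴ) {t : ℝ} (ht : 0 ≤ t) :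
    ∑ j, ∑ k, Complex.normSq ((Uᴴ * V) j k) * l j ^ 2 / (m k + t * l j)
      ≤ ∑ i, p i ^ 2 / (q i + t * p i) := by
  set W := Uᴴ * V with hW
  set F := ∑ j, ∑ k, Complex.normSq (W j k) * l j ^ 2 / (m k + t * l j) with hF
  -- With `ρ`, `σ` the two mixtures, `X = U Y Vᴴ` solves `t ρ X + X σ = ρ`, which is entrywise
  -- division in the two eigenbases.
  set Y : Matrix a a ℂ := of fun j k => ((l j / (m k + t * l j) : ℝ) : ℂ) * W j k with hY
  set X := U * Y * Vᴴ with hX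
  have hXh : Xᴴ = V * Yᴴ * Uᴴ := by simp [hX, Matrix.mul_assoc]
  have e1 : ((∑ i, (p i : ℂ) • τ i) * Xᴴ).trace = (F : ℂ) := by
    have : ((∑ i, (p i : ℂ) • τ i) * Xᴴ).trace
        = (diagonal (fun i => (l i : ℂ)) * W * Yᴴ).trace := by
      rw [hρ, hXh, hW, Matrix.mul_assoc, Matrix.mul_assoc, trace_mul_comm]
      simp only [Matrix.mul_assoc, hU, Matrix.mul_one]
    rw [this, trace_diagonal_mul_mul_conjTranspose, hF]
    push_cast
    refine Finset.sum_congr rfl fun j _ => Finset.sum_congr rfl fun k _ => ?_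
    simp only [hY, of_apply, star_mul', Complex.star_def, Complex.conj_ofReal]
    rw [Complex.normSq_eq_conj_mul_self]
    push_cast
    ring
  have e2 : ((∑ i, (p i : ℂ) • τ i) * (X * Xᴴ)).trace
      = ((∑ j, ∑ k, l j * ((l j / (m k + t * l j)) ^ 2 * Complex.normSq (W j k)) : ℝ) : ℂ) := by
    have : ((∑ i, (p i : ℂ) • τ i) * (X * Xᴴ)).trace
        = (diagonal (fun i => (l i : ℂ)) * Y * Yᴴ).trace := by
      rw [hρ, hXh, hX]
      have : U * diagonal (fun i => (l i : ℂ)) * Uᴴ * (U * Y * Vᴴ * (V * Yᴴ * Uᴴ))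
          = U * (diagonal (fun i => (l i : ℂ)) * (Uᴴ * U) * Y * (Vᴴ * V) * Yᴴ * Uᴴ) := by
        simp only [Matrix.mul_assoc]
      rw [this, hU, hV, trace_mul_comm]
      simp only [Matrix.mul_assoc, hU, Matrix.mul_one]
    rw [this, trace_diagonal_mul_mul_conjTranspose]
    push_cast
    refine Finset.sum_congr rfl fun j _ => Finset.sum_congr rfl fun k _ => ?_
    simp only [hY, of_apply, star_mul', Complex.star_def, Complex.conj_ofReal]
    rw [Complex.normSq_eq_conj_mul_self]
    push_cast
    ring
  have e3 : ((∑ i, (q i : ℂ) • τ i) * (Xᴴ * X)).trace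
      = ((∑ j, ∑ k, m k * ((l j / (m k + t * l j)) ^ 2 * Complex.normSq (W j k)) : ℝ) : ℂ) := by
    have : ((∑ i, (q i : ℂ) • τ i) * (Xᴴ * X)).trace
        = (diagonal (fun i => (m i : ℂ)) * (Yᴴ * Y)).trace := by
      rw [hσ, hXh, hX]
      have : V * diagonal (fun i => (m i : ℂ)) * Vᴴ * (V * Yᴴ * Uᴴ * (U * Y * Vᴴ))
          = V * (diagonal (fun i => (m i : ℂ)) * (Vᴴ * V) * Yᴴ * (Uᴴ * U) * Y * Vᴴ) := by
        simp only [Matrix.mul_assoc]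
      rw [this, hU, hV, trace_mul_comm]
      simp only [Matrix.mul_assoc, hV, Matrix.mul_one]
    rw [this, trace_diagonal_mul_conjTranspose_mul]
    push_cast
    refine Finset.sum_congr rfl fun j _ => Finset.sum_congr rfl fun k _ => ?_
    simp only [hY, of_apply, star_mul', Complex.star_def, Complex.conj_ofReal]
    rw [Complex.normSq_eq_conj_mul_self]
    push_cast
    ring
  have e4 : t * ((∑ i, (p i : ℂ) • τ i) * (X * Xᴴ)).trace.re
      + ((∑ i, (q i : ℂ) • τ i) * (Xᴴ * X)).trace.re = F := by
    rw [e2, e3, Complex.ofReal_re, Complex.ofReal_re, hF, Finset.mul_sum, ← Finset.sum_add_distrib]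
    refine Finset.sum_congr rfl fun j _ => ?_
    rw [Finset.mul_sum, ← Finset.sum_add_distrib]
    refine Finset.sum_congr rfl fun k _ => ?_
    -- A zero denominator makes both sides zero, as `x / 0 = 0`.
    rcases eq_or_ne (m k + t * l j) 0 with h | h
    · simp [h]
    · field_simp
      ring
  have s (c : ι → ℝ) (Z : Matrix a a ℂ) :
      ((∑ i, (c i : ℂ) • τ i) * Z).trace.re = ∑ i, c i * (τ i * Z).trace.re := by
    simp [Finset.sum_mul, trace_sum]
  -- Writing `F = 2F - F` gives an expression linear in the two mixtures for fixed `X`, so it splits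
  -- over `i`.
  have hFe : F = ∑ i, (2 * (p i * (τ i * Xᴴ).trace.re) - t * (p i * (τ i * (X * Xᴴ)).trace.re)
      - q i * (τ i * (Xᴴ * X)).trace.re) := by
    rw [Finset.sum_sub_distrib, Finset.sum_sub_distrib, ← Finset.mul_sum, ← Finset.mul_sum,
      ← s, ← s, ← s, e1, Complex.ofReal_re]
    linarith
  rw [hFe]
  refine Finset.sum_le_sum fun i _ => ?_
  have c1 := (hτ i).normSq_trace_mul_le Xᴴ
  have c2 := (hτ i).normSq_trace_mul_le X
  have c3 : (τ i * X).trace = star (τ i * Xᴴ).trace := by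
    rw [← trace_conjTranspose, conjTranspose_mul, (hτ i).posSemidef.1.eq, trace_mul_comm,
      conjTranspose_conjTranspose]
  rw [c3, Complex.star_def, Complex.normSq_conj] at c2
  rw [conjTranspose_conjTranspose] at c1
  have c4 : (τ i * Xᴴ).trace.re ^ 2 ≤ Complex.normSq (τ i * Xᴴ).trace := by
    rw [Complex.normSq_apply]; nlinarith [mul_self_nonneg (τ i * Xᴴ).trace.im]
  generalize (τ i * Xᴴ).trace.re = r at *
  generalize (τ i * (X * Xᴴ)).trace.re = s₁ at *
  generalize (τ i * (Xᴴ * X)).trace.re = s₂ at *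
  have hd : 0 < q i + t * p i := add_pos_of_pos_of_nonneg (hq i) (mul_nonneg ht (hp i))
  have k1 : t * p i * r ^ 2 ≤ t * p i * s₁ :=
    mul_le_mul_of_nonneg_left (c4.trans c1) (mul_nonneg ht (hp i))
  have k2 : q i * r ^ 2 ≤ q i * s₂ := mul_le_mul_of_nonneg_left (c4.trans c2) (hq i).le
  -- The quadratic in `r` has maximum `p i ^ 2 / (q i + t * p i)`; the difference is a completed
  -- square.
  calc _ ≤ 2 * (p i * r) - (q i + t * p i) * r ^ 2 := by linarith
    _ ≤ _ := by
      rw [le_div_iff₀ hd]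
      nlinarith [sq_nonneg (p i - (q i + t * p i) * r)]

/-- If the sums of `c / (m + t l)`-type derivatives are ordered for every `t ≥ 0`, then so are the
sums of logarithms obtained by integration. -/
theorem sum_log_le_of_sum_div_le {ι κ : Type*} [Fintype ι] [Fintype κ] {p q : ι → ℝ}
    {c l m : κ → ℝ} (hp : ∀ i, 0 ≤ p i) (hq : ∀ i, 0 < q i) (hc : ∀ j, 0 ≤ c j)
    (hl : ∀ j, c j ≠ 0 → 0 < l j) (hm : ∀ j, c j ≠ 0 → 0 < m j) (hcp : ∑ j, c j = ∑ i, p i)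
    (h : ∀ t, 0 ≤ t → ∑ j, c j * l j / (m j + t * l j) ≤ ∑ i, p i ^ 2 / (q i + t * p i)) :
    ∑ j, c j * (Real.log (l j) - Real.log (m j)) ≤ ∑ i, p i * Real.log (p i / q i) := by
  -- The antiderivative in `t` of the difference of the two sides of `h`, normalized to vanish at
  -- `0`.
  set G : ℝ → ℝ := fun t => ∑ i, p i * (Real.log (q i + t * p i) - Real.log (q i))
    - ∑ j, c j * (Real.log (m j + t * l j) - Real.log (m j)) with hG
  have hd : ∀ t, 0 ≤ t → HasDerivAt G (∑ i, p i ^ 2 / (q i + t * p i)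
      - ∑ j, c j * l j / (m j + t * l j)) t := by
    intro t ht
    refine HasDerivAt.sub (HasDerivAt.fun_sum fun i _ => ?_) (HasDerivAt.fun_sum fun j _ => ?_)
    · have hpos : q i + t * p i ≠ 0 := (add_pos_of_pos_of_nonneg (hq i) (mul_nonneg ht (hp i))).ne'
      have := ((((hasDerivAt_id t).mul_const (p i)).const_add (q i)).log hpos).sub_const
        (Real.log (q i)) |>.const_mul (p i)
      exact this.congr_deriv (by simp only [id]; ring)
    · rcases eq_or_ne (c j) 0 with h0 | h0
      · simpa [h0] using hasDerivAt_const t (0 : ℝ)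
      · have hpos : m j + t * l j ≠ 0 :=
          (add_pos_of_pos_of_nonneg (hm j h0) (mul_nonneg ht (hl j h0).le)).ne'
        have := ((((hasDerivAt_id t).mul_const (l j)).const_add (m j)).log hpos).sub_const
          (Real.log (m j)) |>.const_mul (c j)
        exact this.congr_deriv (by simp only [id]; ring)
  have hmono : MonotoneOn G (Set.Ici 0) := by
    refine monotoneOn_of_deriv_nonneg (convex_Ici 0)
      (fun t ht => (hd t ht).continuousAt.continuousWithinAt)
      (fun t ht => (hd t (interior_subset ht)).differentiableAt.differentiableWithinAt)
      fun t ht => ?_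
    rw [(hd t (interior_subset ht)).deriv]
    exact sub_nonneg.2 (h t (interior_subset ht))
  -- Both sums of logarithms grow like their total weight times `log t`. The weights agree by `hcp`,
  -- so these terms cancel and `t → ∞` can be taken.
  have hG0 : ∀ t, 0 < t → ∑ j, c j * (Real.log (l j) - Real.log (m j))
      ≤ ∑ i, p i * (Real.log (p i + q i * t⁻¹) - Real.log (q i)) := by
    intro t ht
    have h0 : G 0 ≤ G t := hmono Set.self_mem_Ici ht.le ht.le
    have h1 : G 0 = 0 := by simp [hG]
    have h2 : ∑ i, p i * (Real.log (q i + t * p i) - Real.log (q i))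
        = ∑ i, p i * (Real.log (p i + q i * t⁻¹) - Real.log (q i))
          + (∑ i, p i) * Real.log t := by
      rw [Finset.sum_mul, ← Finset.sum_add_distrib]
      refine Finset.sum_congr rfl fun i _ => ?_
      have : q i + t * p i = t * (p i + q i * t⁻¹) := by field_simp; ring
      rw [this, Real.log_mul ht.ne' (add_pos_of_nonneg_of_pos (hp i)
        (mul_pos (hq i) (inv_pos.2 ht))).ne']
      ring
    have h3 : ∑ j, c j * (Real.log (l j) - Real.log (m j)) + (∑ j, c j) * Real.log t
        ≤ ∑ j, c j * (Real.log (m j + t * l j) - Real.log (m j)) := by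
      rw [Finset.sum_mul, ← Finset.sum_add_distrib]
      refine Finset.sum_le_sum fun j _ => ?_
      rcases eq_or_ne (c j) 0 with h0 | h0
      · simp [h0]
      · have : Real.log t + Real.log (l j) ≤ Real.log (m j + t * l j) := by
          rw [← Real.log_mul ht.ne' (hl j h0).ne']
          exact Real.log_le_log (mul_pos ht (hl j h0)) (by linarith [hm j h0])
        nlinarith [mul_le_mul_of_nonneg_left this (hc j)]
    rw [h1] at h0
    simp only [hG] at h0
    rw [hcp] at h3
    linarith
  have hlim : Filter.Tendsto
      (fun t : ℝ => ∑ i, p i * (Real.log (p i + q i * t⁻¹) - Real.log (q i))) Filter.atTop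
      (nhds (∑ i, p i * Real.log (p i / q i))) := by
    refine tendsto_finsetSum _ fun i _ => ?_
    rcases eq_or_ne (p i) 0 with h0 | h0
    · simp [h0]
    · rw [Real.log_div h0 (hq i).ne']
      refine (Filter.Tendsto.sub_const ?_ _).const_mul _
      have : Filter.Tendsto (fun t : ℝ => p i + q i * t⁻¹) Filter.atTop (nhds (p i)) := by
        simpa using (tendsto_inv_atTop_zero.const_mul (q i)).const_add (p i)
      exact this.log h0
  exact ge_of_tendsto hlim ((Filter.eventually_gt_atTop 0).mono hG0)

/-- Nonnegative forms with positive weights sum to zero only if each vanishes, so `v` lies in every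
kernel. This keeps the relative entropy of two mixtures finite. -/
theorem mulVec_sum_smul_eq_zero {c ι : Type*} [Fintype c] [Fintype ι] {τ : ι → Matrix c c ℂ}
    (hτ : ∀ i, (τ i).PosSemidef) {q : ι → ℝ} (hq : ∀ i, 0 < q i) (p : ι → ℝ) {v : c → ℂ}
    (hv : (∑ i, (q i : ℂ) • τ i) *ᵥ v = 0) : (∑ i, (p i : ℂ) • τ i) *ᵥ v = 0 := by
  have h : ∑ i, (q i : ℂ) * (star v ⬝ᵥ (τ i *ᵥ v)) = 0 := by
    have := congrArg (star v ⬝ᵥ ·) hv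
    simpa [sum_mulVec, dotProduct_sum, smul_mulVec, dotProduct_smul] using this
  rw [Finset.sum_eq_zero_iff_of_nonneg fun i _ =>
    mul_nonneg (by exact_mod_cast (hq i).le) ((hτ i).dotProduct_mulVec_nonneg v)] at h
  have hz : ∀ i, τ i *ᵥ v = 0 := fun i => by
    rw [← (hτ i).dotProduct_mulVec_zero_iff]
    exact (mul_eq_zero.1 (h i (Finset.mem_univ i))).resolve_left (by exact_mod_cast (hq i).ne')
  simp [sum_mulVec, smul_mulVec, hz]

theorem sum_normSq_row {c d : Type*} [DecidableEq c] [Fintype d] {W : Matrix c d ℂ}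
    (hW : W * Wᴴ = 1) (j : c) :
    ∑ k, Complex.normSq (W j k) = 1 := by
  have := congrFun (congrFun hW j) j
  simp only [mul_apply, conjTranspose_apply, one_apply_eq, Complex.star_def,
    Complex.mul_conj] at this
  exact_mod_cast this

/-- Monotonicity of the relative entropy under the preparation of states `τ i` with weights
`p i` and `q i`. -/
theorem relEntropy_sum_smul_le {ι : Type*} [Fintype ι] {τ : ι → Matrix a a ℂ}
    (hτ : ∀ i, IsDensity (τ i)) {p q : ι → ℝ} (hp : ∀ i, 0 ≤ p i) (hq : ∀ i, 0 < q i) :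
    relEntropy (∑ i, (p i : ℂ) • τ i) (∑ i, (q i : ℂ) • τ i)
      ≤ ((∑ i, p i * Real.log (p i / q i) : ℝ) : EReal) := by
  have hps (c : ι → ℝ) (hc : ∀ i, 0 ≤ c i) : (∑ i, (c i : ℂ) • τ i).PosSemidef :=
    posSemidef_sum _ fun i _ => (hτ i).posSemidef.smul (by exact_mod_cast hc i)
  have hker := fun v => mulVec_sum_smul_eq_zero (fun i => (hτ i).posSemidef) hq p (v := v)
  rw [relEntropy, if_pos hker, EReal.coe_le_coe_iff]
  obtain ⟨U, l, hU, -, hl, hρ, hρl⟩ := exists_diagonalization (hps p hp)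
  obtain ⟨V, m, hV, hV', hm, hσ, hσl⟩ := exists_diagonalization (hps q fun i => (hq i).le)
  have hres := fun t ht => sum_resolvent_le hτ hp hq hU hV hρ hσ (t := t) ht
  have htr : (∑ i, (p i : ℂ) • τ i).trace = ((∑ i, p i : ℝ) : ℂ) := by
    simp [trace_sum, (hτ _).trace_eq_one]
  rw [hρl, hσl]
  rw [hρ] at hker htr ⊢
  rw [hσ] at hker
  set W := Uᴴ * V with hW
  have hWW : W * Wᴴ = 1 := by
    rw [hW, conjTranspose_mul, conjTranspose_conjTranspose, Matrix.mul_assoc,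
      ← Matrix.mul_assoc V, hV', Matrix.one_mul, hU]
  -- The kernel inclusion in eigenbases: pairs with `m k = 0` carry no weight, so `log 0` never
  -- matters.
  have hzero : ∀ j k, m k = 0 → (l j : ℂ) * W j k = 0 := by
    intro j k hk
    have h1 := hker (V *ᵥ Pi.single k 1) (by
      rw [mulVec_mulVec, Matrix.mul_assoc, hV, Matrix.mul_one, ← mulVec_mulVec,
        diagonal_mulVec_single]
      simp [hk])
    have h2 := congrArg (Uᴴ *ᵥ ·) h1
    simp only [mulVec_mulVec, mulVec_zero] at h2
    have h3 : Uᴴ * (U * diagonal (fun i => (l i : ℂ)) * Uᴴ * V)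
        = diagonal (fun i => (l i : ℂ)) * W := by
      rw [Matrix.mul_assoc, Matrix.mul_assoc, ← Matrix.mul_assoc, hU, Matrix.one_mul]
    rw [h3] at h2
    simpa [diagonal_mul] using congrFun h2 j
  have t1 : (U * diagonal (fun i => (l i : ℂ)) * Uᴴ
      * (U * diagonal (fun i => (Real.log (l i) : ℂ)) * Uᴴ
        - V * diagonal (fun i => (Real.log (m i) : ℂ)) * Vᴴ)).trace.re
      = ∑ x : a × a, Complex.normSq (W x.1 x.2) * l x.1
          * (Real.log (l x.1) - Real.log (m x.2)) := by
    have r1 : (U * diagonal (fun i => (l i : ℂ)) * Uᴴ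
        * (U * diagonal (fun i => (Real.log (l i) : ℂ)) * Uᴴ)).trace
        = ((∑ j, l j * Real.log (l j) : ℝ) : ℂ) := by
      have : U * diagonal (fun i => (l i : ℂ)) * Uᴴ
          * (U * diagonal (fun i => (Real.log (l i) : ℂ)) * Uᴴ)
          = U * (diagonal (fun i => (l i : ℂ)) * (Uᴴ * U)
            * diagonal (fun i => (Real.log (l i) : ℂ)) * Uᴴ) := by simp only [Matrix.mul_assoc]
      rw [this, hU, trace_mul_comm, Matrix.mul_assoc, hU, Matrix.mul_one, Matrix.mul_one,
        diagonal_mul_diagonal, trace_diagonal]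
      push_cast; rfl
    have r2 : (U * diagonal (fun i => (l i : ℂ)) * Uᴴ
        * (V * diagonal (fun i => (Real.log (m i) : ℂ)) * Vᴴ)).trace
        = ((∑ j, ∑ k, Complex.normSq (W j k) * l j * Real.log (m k) : ℝ) : ℂ) := by
      have e1 : U * diagonal (fun i => (l i : ℂ)) * Uᴴ
          * (V * diagonal (fun i => (Real.log (m i) : ℂ)) * Vᴴ)
          = U * (diagonal (fun i => (l i : ℂ)) * (W * diagonal (fun i => (Real.log (m i) : ℂ)))
            * Vᴴ) := by
        simp only [hW, Matrix.mul_assoc]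
      have e2 : Vᴴ * U = Wᴴ := by simp [hW]
      rw [e1, trace_mul_comm, Matrix.mul_assoc, e2, trace_diagonal_mul_mul_conjTranspose]
      push_cast
      refine Finset.sum_congr rfl fun j _ => Finset.sum_congr rfl fun k _ => ?_
      rw [mul_diagonal, Complex.normSq_eq_conj_mul_self, Complex.star_def]
      ring
    rw [Matrix.mul_sub, trace_sub, Complex.sub_re, r1, r2, Complex.ofReal_re, Complex.ofReal_re,
      Fintype.sum_prod_type, ← Finset.sum_sub_distrib]
    refine Finset.sum_congr rfl fun j _ => ?_
    simp only [mul_sub, Finset.sum_sub_distrib]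
    rw [← Finset.sum_mul, ← Finset.sum_mul, sum_normSq_row hWW, one_mul]
  rw [t1]
  -- The quantum divergence is a classical sum over pairs of eigenvectors, weighted by squared
  -- overlap times the eigenvalue of the first mixture.
  refine sum_log_le_of_sum_div_le hp hq (c := fun x : a × a => Complex.normSq (W x.1 x.2) * l x.1)
    (l := fun x => l x.1) (m := fun x => m x.2)
    (fun x => mul_nonneg (Complex.normSq_nonneg _) (hl _)) (fun x hx => ?_) (fun x hx => ?_) ?_ ?_
  · exact lt_of_le_of_ne (hl _) fun h => hx (by rw [← h, mul_zero])
  · refine lt_of_le_of_ne (hm _) fun h => hx ?_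
    rcases mul_eq_zero.1 (hzero x.1 x.2 h.symm) with h' | h'
    · rw [Complex.ofReal_eq_zero.1 h', mul_zero]
    · rw [h', map_zero, zero_mul]
  · rw [Fintype.sum_prod_type]
    simp only [← Finset.sum_mul, sum_normSq_row hWW, one_mul]
    rw [trace_mul_comm, ← Matrix.mul_assoc, hU, Matrix.one_mul, trace_diagonal] at htr
    exact_mod_cast htr
  · intro t ht
    rw [Fintype.sum_prod_type]
    refine le_trans (le_of_eq ?_) (hres t ht)
    refine Finset.sum_congr rfl fun j _ => Finset.sum_congr rfl fun k _ => ?_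
    ring

/-! ### Choi matrices and operator sums -/

theorem choi_apply {a b : Type*} [Fintype a] [DecidableEq a] [Fintype b]
    (Φ : Matrix a a ℂ →ₗ[ℂ] Matrix b b ℂ) (x y : b × a) :
    choi Φ x y = Φ (single x.2 y.2 1) x.1 y.1 := by
  have : (Matrix.of fun k l => vecMulVec (phiPlus a) (star (phiPlus a)) (k, x.2) (l, y.2))
      = single x.2 y.2 (1 : ℂ) := by
    ext k l
    simp only [of_apply, vecMulVec_apply, phiPlus, Pi.star_apply, single_apply]
    by_cases h : k = x.2 <;> by_cases h' : l = y.2 <;> simp [h, h', eq_comm]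
  simp [choi, extend, this]

theorem apply_eq_sum_choi {a b : Type*} [Fintype a] [DecidableEq a] [Fintype b]
    (Φ : Matrix a a ℂ →ₗ[ℂ] Matrix b b ℂ) (X : Matrix a a ℂ) (i j : b) :
    Φ X i j = ∑ s, ∑ t, X s t * choi Φ (i, s) (j, t) := by
  conv_lhs => rw [matrix_eq_sum_single X]
  simp only [map_sum, Matrix.sum_apply, choi_apply]
  refine Finset.sum_congr rfl fun s _ => Finset.sum_congr rfl fun t _ => ?_
  rw [← mul_one (X s t), ← smul_eq_mul (X s t) 1, ← smul_single, map_smul]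
  simp

/-- An operator-sum representation, read off from the Choi matrix, of the extended map. -/
theorem extend_eq_sum_of_choi {a b r ι : Type*} [Fintype a] [DecidableEq a] [Fintype b]
    [Fintype r] [DecidableEq r] [Fintype ι] {Φ : Matrix a a ℂ →ₗ[ℂ] Matrix b b ℂ}
    {K : ι → Matrix b a ℂ} {c : ι → ℂ}
    (h : ∀ x y, choi Φ x y = ∑ i, c i * (K i x.1 x.2 * star (K i y.1 y.2)))
    (ρ : Matrix (a × r) (a × r) ℂ) :
    extend r Φ ρ = ∑ i, c i • (kroneckerMap (· * ·) (K i) (1 : Matrix r r ℂ) * ρ *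
      (kroneckerMap (· * ·) (K i) (1 : Matrix r r ℂ))ᴴ) := by
  ext ⟨i, s⟩ ⟨j, t⟩
  simp only [extend, of_apply, apply_eq_sum_choi Φ, h, Matrix.sum_apply, Matrix.smul_apply,
    smul_eq_mul, mul_apply, conjTranspose_apply, kroneckerMap_apply, Fintype.sum_prod_type, one_apply,
    mul_ite, mul_one, mul_zero, ite_mul, zero_mul, Finset.sum_ite_eq, Finset.mem_univ, if_true,
    apply_ite (star : ℂ → ℂ), star_zero, Finset.mul_sum, Finset.sum_mul]
  rw [Finset.sum_comm]
  simp only [Finset.sum_comm (s := (Finset.univ : Finset a)) (t := (Finset.univ : Finset ι))]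
  refine Finset.sum_congr rfl fun k _ => Finset.sum_congr rfl fun l _ =>
    Finset.sum_congr rfl fun m _ => ?_
  ring

theorem IsDensity.kronecker_one {a r : Type*} [Fintype a] [DecidableEq a]
    [Fintype r] [DecidableEq r] {U : Matrix a a ℂ} (hU : Uᴴ * U = 1)
    {ρ : Matrix (a × r) (a × r) ℂ} (hρ : IsDensity ρ) :
    IsDensity (kroneckerMap (· * ·) U (1 : Matrix r r ℂ) * ρ *
      (kroneckerMap (· * ·) U (1 : Matrix r r ℂ))ᴴ) := by
  refine ⟨hρ.posSemidef.mul_mul_conjTranspose_same _, ?_⟩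
  have h : (kroneckerMap (· * ·) U (1 : Matrix r r ℂ))ᴴ * kroneckerMap (· * ·) U (1 : Matrix r r ℂ)
      = 1 := by
    rw [conjTranspose_kronecker, conjTranspose_one, ← mul_kronecker_mul, hU, Matrix.one_mul,
      one_kronecker_one]
  rw [Matrix.mul_assoc, trace_mul_comm, Matrix.mul_assoc, h, Matrix.mul_one, hρ.trace_eq_one]

/-! ### Unital qubit channels as mixtures of unitaries -/

/-- The vectorizations of the quaternion units `1, i σ_z, i σ_y, i σ_x`, as columns. A
real combination of these matrices is a real multiple of a unitary matrix. -/
def quaternionBasis : Matrix (Fin 2 × Fin 2) (Fin 4) ℂ :=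
  Matrix.of fun x => (!![1, Complex.I, 0, 0; 0, 0, 1, Complex.I; 0, 0, -1, Complex.I;
    1, -Complex.I, 0, 0] : Matrix (Fin 4) (Fin 4) ℂ) (finProdFinEquiv x)

theorem quaternionBasis_conjTranspose_mul :
    quaternionBasisᴴ * quaternionBasis = (2 : ℂ) • (1 : Matrix (Fin 4) (Fin 4) ℂ) := by
  ext i j
  fin_cases i <;> fin_cases j <;>
    simp [quaternionBasis, mul_apply, Fintype.sum_prod_type, finProdFinEquiv] <;> norm_num

theorem quaternionBasis_mul_conjTranspose :
    quaternionBasis * quaternionBasisᴴ = (2 : ℂ) • (1 : Matrix (Fin 2 × Fin 2) _ ℂ) := by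
  ext ⟨i, i'⟩ ⟨j, j'⟩
  fin_cases i <;> fin_cases i' <;> fin_cases j <;> fin_cases j' <;>
    simp [quaternionBasis, mul_apply, Fin.sum_univ_four, finProdFinEquiv] <;> norm_num

/-- In the quaternion basis, the Choi matrix of a trace-preserving unital qubit map is
symmetric. -/
theorem quaternionBasis_choi_symm {Φ : Matrix (Fin 2) (Fin 2) ℂ →ₗ[ℂ] Matrix (Fin 2) (Fin 2) ℂ}
    (htr : ∀ ρ, (Φ ρ).trace = ρ.trace) (h1 : Φ 1 = 1) :
    (quaternionBasisᴴ * choi Φ * quaternionBasis)ᵀ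
      = quaternionBasisᴴ * choi Φ * quaternionBasis := by
  -- Both partial traces are the identity, which kills the terms `σᵢ ⊗ 1` and `1 ⊗ σⱼ`. These act as
  -- left and right multiplication by imaginary quaternions, up to scalars, so are antisymmetric in
  -- this basis; their commuting products `σᵢ ⊗ σⱼ` are symmetric.
  have hu (i j : Fin 2) : ∑ s, choi Φ (i, s) (j, s) = (1 : Matrix _ _ ℂ) i j := by
    rw [← h1, apply_eq_sum_choi]
    simp [one_apply]
  have ht (s t : Fin 2) : ∑ i, choi Φ (i, s) (i, t) = (1 : Matrix _ _ ℂ) s t := by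
    have := htr (single s t 1)
    simp only [trace, diag_apply] at this
    simp only [choi_apply, this]
    fin_cases s <;> fin_cases t <;> simp
  generalize choi Φ = C at *
  have u00 := hu 0 0
  have u01 := hu 0 1
  have u10 := hu 1 0
  have u11 := hu 1 1
  have t00 := ht 0 0
  have t01 := ht 0 1
  have t10 := ht 1 0
  have t11 := ht 1 1
  simp [Fin.sum_univ_two] at u00 u01 u10 u11 t00 t01 t10 t11
  have hI := Complex.I_mul_I
  ext i j
  fin_cases i <;> fin_cases j <;>
    simp [quaternionBasis, mul_apply, Fintype.sum_prod_type, finProdFinEquiv] <;> grind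

/-- A unital qubit channel is a mixture of four unitaries, orthogonal in the Hilbert-Schmidt inner
product. Their vectorizations are the columns of `V`. -/
theorem exists_choi_eq {Φ : Matrix (Fin 2) (Fin 2) ℂ →ₗ[ℂ] Matrix (Fin 2) (Fin 2) ℂ}
    (hΦ : IsChannel Φ) (h1 : Φ 1 = 1) :
    ∃ (p : Fin 4 → ℝ) (V : Matrix (Fin 2 × Fin 2) (Fin 4) ℂ), (∀ i, 0 ≤ p i) ∧
      Vᴴ * V = (2 : ℂ) • 1 ∧ V * Vᴴ = (2 : ℂ) • 1 ∧
      (∀ i, (of fun k l => V (k, l) i)ᴴ * (of fun k l => V (k, l) i) = 1) ∧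
      choi Φ = V * diagonal (fun i => (p i : ℂ)) * Vᴴ := by
  have hC : (choi Φ).PosSemidef := hΦ.completely_positive 2 _ (posSemidef_vecMulVec_self_star _)
  set B := quaternionBasis with hB
  -- The factor `1/4` undoes `B * Bᴴ = 2` on both sides.
  set G : Matrix (Fin 4) (Fin 4) ℂ := (4 : ℂ)⁻¹ • (Bᴴ * choi Φ * B) with hG
  have hGp : G.PosSemidef := (hC.conjTranspose_mul_mul_same B).smul (by rw [inv_nonneg]; norm_num)
  have hGs : Gᵀ = G := by
    rw [hG, transpose_smul, hB, quaternionBasis_choi_symm hΦ.trace_preserving h1]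
  have hCG : choi Φ = B * G * Bᴴ := by
    have : B * (Bᴴ * choi Φ * B) * Bᴴ = (B * Bᴴ) * choi Φ * (B * Bᴴ) := by
      simp only [Matrix.mul_assoc]
    rw [hG, Matrix.mul_smul, Matrix.smul_mul, this, hB, quaternionBasis_mul_conjTranspose]
    simp only [Matrix.smul_mul, Matrix.mul_smul, Matrix.one_mul, Matrix.mul_one, smul_smul]
    norm_num
  -- `G` is Hermitian and symmetric, hence real.
  set R : Matrix (Fin 4) (Fin 4) ℝ := G.map Complex.re with hR
  have hRG : R.map Complex.ofReal = G := by
    ext i j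
    have h2 := congrFun (congrFun hGp.1.eq i) j
    have h3 := congrFun (congrFun hGs i) j
    rw [conjTranspose_apply] at h2
    rw [transpose_apply] at h3
    rw [h3, Complex.star_def] at h2
    simpa [hR] using Complex.conj_eq_iff_re.1 h2
  have hRh : R.IsHermitian := by
    ext i j
    have h3 := congrFun (congrFun hGs i) j
    rw [transpose_apply] at h3
    simp [hR, h3]
  set O : Matrix (Fin 4) (Fin 4) ℝ := ↑hRh.eigenvectorUnitary with hO
  have hO1 : Oᵀ * O = 1 := by
    have := Unitary.coe_star_mul_self hRh.eigenvectorUnitary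
    rwa [star_eq_conjTranspose, conjTranspose_eq_transpose_of_trivial] at this
  have hRO : R = O * diagonal hRh.eigenvalues * Oᵀ := by
    conv_lhs => rw [hRh.spectral_theorem, Unitary.conjStarAlgAut_apply]
    rw [star_eq_conjTranspose, conjTranspose_eq_transpose_of_trivial]
    rfl
  set P := O.map Complex.ofReal with hP
  have hPh : Pᴴ = Oᵀ.map Complex.ofReal := by
    ext i j; simp [hP]
  have hmul (X Y : Matrix (Fin 4) (Fin 4) ℝ) :
      (X * Y).map Complex.ofReal = X.map Complex.ofReal * Y.map Complex.ofReal :=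
    Matrix.map_mul (f := Complex.ofRealHom)
  have hP1 : Pᴴ * P = 1 := by
    rw [hPh, hP, ← hmul, hO1]
    exact Matrix.map_one _ Complex.ofReal_zero Complex.ofReal_one
  have hP2 : P * Pᴴ = 1 := mul_eq_one_comm.1 hP1
  have hGP : G = P * diagonal (fun i => (hRh.eigenvalues i : ℂ)) * Pᴴ := by
    rw [← hRG]
    conv_lhs => rw [hRO]
    rw [hPh, hP, hmul, hmul]
    congr 2
    rw [diagonal_map Complex.ofReal_zero]
  refine ⟨hRh.eigenvalues, B * P, fun i => ?_, ?_, ?_, fun i => ?_, ?_⟩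
  · have h := hGp.conjTranspose_mul_mul_same P
    have : Pᴴ * G * P = diagonal (fun i => (hRh.eigenvalues i : ℂ)) := by
      have : Pᴴ * (P * diagonal (fun i => (hRh.eigenvalues i : ℂ)) * Pᴴ) * P
        = (Pᴴ * P) * diagonal (fun i => (hRh.eigenvalues i : ℂ)) * (Pᴴ * P) := by
        simp only [Matrix.mul_assoc]
      rw [hGP, this, hP1, Matrix.one_mul, Matrix.mul_one]
    rw [this, posSemidef_diagonal_iff] at h
    exact_mod_cast h i
  · rw [conjTranspose_mul, Matrix.mul_assoc, ← Matrix.mul_assoc Bᴴ, hB,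
      quaternionBasis_conjTranspose_mul]
    simp [hP1]
  · rw [conjTranspose_mul, Matrix.mul_assoc, ← Matrix.mul_assoc P, hP2, Matrix.one_mul, hB,
      quaternionBasis_mul_conjTranspose]
  -- The columns of `O` are real unit vectors, and a unit quaternion is a unitary matrix.
  · have h := congrFun (congrFun hO1 i) i
    simp only [mul_apply, transpose_apply, one_apply_eq, Fin.sum_univ_four] at h
    have h' : (O 0 i : ℂ) * O 0 i + O 1 i * O 1 i + O 2 i * O 2 i + O 3 i * O 3 i = 1 := by
      exact_mod_cast h
    have hI := Complex.I_mul_I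
    ext k l
    fin_cases k <;> fin_cases l <;>
      simp [hB, hP, quaternionBasis, mul_apply, Fin.sum_univ_four, Fin.sum_univ_two,
        finProdFinEquiv] <;> grind
  · rw [hCG, hGP, conjTranspose_mul]
    simp only [Matrix.mul_assoc]

/-! ### Entropies and the maximally entangled state -/

theorem vonNeumannEntropy_eq_sum {a ι : Type*} [Fintype a] [DecidableEq a] [Fintype ι]
    [DecidableEq ι] {ρ : Matrix a a ℂ} (hρ : ρ.PosSemidef) {W : Matrix a ι ℂ} (hW : Wᴴ * W = 1)
    {p : ι → ℝ} (h : ρ = W * diagonal (fun i => (p i : ℂ)) * Wᴴ) :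
    vonNeumannEntropy ρ = -∑ i, p i * Real.log (p i) := by
  obtain ⟨U, l, hU, hU', -, hρU, hlog⟩ := exists_diagonalization hρ
  have hρW : ρ * W = W * diagonal (fun i => (p i : ℂ)) := by
    rw [h, Matrix.mul_assoc, hW, Matrix.mul_one]
  have hN : diagonal (fun i => (l i : ℂ)) * (Uᴴ * W)
      = Uᴴ * W * diagonal (fun i => (p i : ℂ)) := by
    rw [Matrix.mul_assoc Uᴴ, ← hρW, hρU]
    simp only [← Matrix.mul_assoc, hU, Matrix.one_mul]
  -- By `hN`, an entry `(j, i)` of `Uᴴ * W` vanishes unless `l j = p i`, so any function of the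
  -- eigenvalues is intertwined as well.
  have hN' : diagonal (fun i => (Real.log (l i) : ℂ)) * (Uᴴ * W)
      = Uᴴ * W * diagonal (fun i => (Real.log (p i) : ℂ)) := by
    ext j i
    have := congrFun (congrFun hN j) i
    rw [diagonal_mul, mul_diagonal, mul_comm] at this ⊢
    rcases mul_eq_mul_left_iff.1 this with h' | h'
    · rw [Complex.ofReal_inj.1 h']
    · rw [h', zero_mul, zero_mul]
  have hlogW : matLog ρ * W = W * diagonal (fun i => (Real.log (p i) : ℂ)) := by
    rw [hlog, Matrix.mul_assoc, Matrix.mul_assoc, hN']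
    simp only [← Matrix.mul_assoc, hU', Matrix.one_mul]
  have : (ρ * matLog ρ).trace = ((∑ i, p i * Real.log (p i) : ℝ) : ℂ) := by
    conv_lhs => rw [trace_mul_comm]; enter [1, 2]; rw [h]
    rw [← Matrix.mul_assoc, ← Matrix.mul_assoc, hlogW, trace_mul_comm, ← Matrix.mul_assoc,
      ← Matrix.mul_assoc, hW, Matrix.one_mul, diagonal_mul_diagonal, trace_diagonal]
    push_cast
    exact Finset.sum_congr rfl fun _ _ => mul_comm _ _
  rw [vonNeumannEntropy, this, Complex.ofReal_re]

theorem relEntropy_smul_one {a : Type*} [Fintype a] [DecidableEq a] {ρ : Matrix a a ℂ}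
    (hρ : ρ.trace = 1) {c : ℝ} (hc : 0 < c) :
    relEntropy ρ ((c : ℂ) • 1) = ((-vonNeumannEntropy ρ - Real.log c : ℝ) : EReal) := by
  have hlog : matLog ((c : ℂ) • (1 : Matrix a a ℂ)) = (Real.log c : ℂ) • 1 := by
    have h (x : ℝ) : (x : ℂ) • (1 : Matrix a a ℂ) = algebraMap ℝ _ x := by
      rw [Algebra.algebraMap_eq_smul_one]; rfl
    rw [matLog, h, cfc_algebraMap, h]
  rw [relEntropy, if_pos, hlog, EReal.coe_eq_coe_iff, vonNeumannEntropy]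
  · simp [Matrix.mul_sub, hρ]
  · intro v hv
    rw [smul_mulVec, one_mulVec, smul_eq_zero] at hv
    rw [hv.resolve_left (by exact_mod_cast hc.ne'), mulVec_zero]

theorem isDensity_maxEntangled (a : Type*) [Fintype a] [DecidableEq a] [Nonempty a] :
    IsDensity (maxEntangled a) := by
  refine ⟨(posSemidef_vecMulVec_self_star _).smul (by rw [inv_nonneg]; exact Nat.cast_nonneg _), ?_⟩
  have : (Fintype.card a : ℂ) ≠ 0 := Nat.cast_ne_zero.2 Fintype.card_ne_zero
  simp [maxEntangled, trace, vecMulVec_apply, phiPlus, Fintype.sum_prod_type, this]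

theorem extend_maxEntangled {a b : Type*} [Fintype a] [DecidableEq a] [Fintype b]
    (Φ : Matrix a a ℂ →ₗ[ℂ] Matrix b b ℂ) : extend a Φ (maxEntangled a) = choiState Φ := by
  ext x y
  simp only [extend, maxEntangled, choiState, choi, of_apply, Matrix.smul_apply]
  rw [← Matrix.smul_apply, ← map_smul]
  rfl

theorem choi_depolarizing (a b : Type*) [Fintype a] [DecidableEq a] [Fintype b] [DecidableEq b] :
    choi (depolarizing a b) = (Fintype.card b : ℂ)⁻¹ • 1 := by
  ext x y
  rw [choi_apply]
  by_cases h : x.2 = y.2 <;> by_cases h' : x.1 = y.1 <;>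
    simp [depolarizing, one_apply, Prod.ext_iff, h, h', trace_single_eq_of_ne]

theorem trace_choiState {a b : Type*} [Fintype a] [DecidableEq a] [Nonempty a] [Fintype b]
    {Φ : Matrix a a ℂ →ₗ[ℂ] Matrix b b ℂ} (htr : ∀ ρ, (Φ ρ).trace = ρ.trace) :
    (choiState Φ).trace = 1 := by
  have h : (choi Φ).trace = Fintype.card a := by
    have (s : a) : ∑ i, Φ (single s s 1) i i = 1 := by
      have := htr (single s s 1)
      rwa [trace_single_eq_same] at this
    simp only [trace, diag_apply, choi_apply, Fintype.sum_prod_type_right, this]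
    simp
  rw [choiState, trace_smul, h, smul_eq_mul, inv_mul_cancel₀]
  exact Nat.cast_ne_zero.2 Fintype.card_ne_zero

theorem channelRelEntropy_depolarizing_qubit
    {Φ : Matrix (Fin 2) (Fin 2) ℂ →ₗ[ℂ] Matrix (Fin 2) (Fin 2) ℂ}
    (hΦ : IsChannel Φ) (h1 : Φ 1 = 1) :
    channelRelEntropy Φ (depolarizing (Fin 2) (Fin 2))
        = relEntropy (extend (Fin 2) Φ (maxEntangled (Fin 2)))
          (extend (Fin 2) (depolarizing (Fin 2) (Fin 2)) (maxEntangled (Fin 2))) ∧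
      relEntropy (extend (Fin 2) Φ (maxEntangled (Fin 2)))
          (extend (Fin 2) (depolarizing (Fin 2) (Fin 2)) (maxEntangled (Fin 2)))
        = ((2 * Real.log 2 - mapEntropy Φ : ℝ) : EReal) := by
  obtain ⟨p, V, hp, hV, hV', hU, hC⟩ := exists_choi_eq hΦ h1
  have htr := trace_choiState hΦ.trace_preserving
  -- Scaling by `1/√2` turns the columns of `V`, of squared norm `2`, into an orthonormal eigenbasis
  -- of the Choi state.
  set r : ℝ := (Real.sqrt 2)⁻¹ with hr
  have hrr : (r : ℂ) * r = 2⁻¹ := by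
    rw [← Complex.ofReal_mul, hr, ← mul_inv, Real.mul_self_sqrt (by norm_num)]
    norm_num
  have hW : ((r : ℂ) • V)ᴴ * ((r : ℂ) • V) = 1 := by
    rw [conjTranspose_smul, Complex.star_def, Complex.conj_ofReal, Matrix.smul_mul,
      Matrix.mul_smul, hV, smul_smul, smul_smul, hrr]
    norm_num
  have hJ : choiState Φ = ((r : ℂ) • V) * diagonal (fun i => (p i : ℂ)) * ((r : ℂ) • V)ᴴ := by
    rw [choiState, hC, conjTranspose_smul, Complex.star_def, Complex.conj_ofReal, Matrix.smul_mul,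
      Matrix.mul_smul, Matrix.smul_mul, smul_smul, hrr]
    simp
  have hCp : (choi Φ).PosSemidef := hΦ.completely_positive 2 _ (posSemidef_vecMulVec_self_star _)
  have hH : mapEntropy Φ = -∑ i, p i * Real.log (p i) :=
    vonNeumannEntropy_eq_sum (hCp.smul (by simp)) hW hJ
  have hsum : ∑ i, p i = 1 := by
    rw [hJ, trace_mul_comm, ← Matrix.mul_assoc, hW, Matrix.one_mul, trace_diagonal] at htr
    exact_mod_cast htr
  have hmax : relEntropy (extend (Fin 2) Φ (maxEntangled (Fin 2)))
      (extend (Fin 2) (depolarizing (Fin 2) (Fin 2)) (maxEntangled (Fin 2)))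
        = ((2 * Real.log 2 - mapEntropy Φ : ℝ) : EReal) := by
    have : choiState (depolarizing (Fin 2) (Fin 2)) = (((4⁻¹ : ℝ) : ℂ)) • 1 := by
      rw [choiState, choi_depolarizing, smul_smul]
      norm_num
    rw [extend_maxEntangled, extend_maxEntangled, this, relEntropy_smul_one htr (by norm_num),
      mapEntropy, Real.log_inv, show (4 : ℝ) = 2 ^ 2 by norm_num, Real.log_pow]
    rw [EReal.coe_eq_coe_iff]
    push_cast
    ring
  refine ⟨le_antisymm ?_ ?_, hmax⟩
  · rw [hmax]
    refine iSup_le fun n => iSup_le fun ρ => iSup_le fun hρ => ?_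
    set K : Fin 4 → Matrix (Fin 2) (Fin 2) ℂ := fun i => of fun k l => V (k, l) i with hK
    have hΦK : ∀ x y, choi Φ x y = ∑ i, (p i : ℂ) * (K i x.1 x.2 * star (K i y.1 y.2)) := by
      intro x y
      rw [hC, mul_apply]
      refine Finset.sum_congr rfl fun i _ => ?_
      rw [mul_diagonal, conjTranspose_apply]
      simp only [hK, of_apply]
      ring
    -- The Choi matrix of `depolarizing` is `1/2` and `V * Vᴴ = 2`, hence the uniform weight `1/4`.
    have hRK : ∀ x y, choi (depolarizing (Fin 2) (Fin 2)) x y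
        = ∑ i, (((4⁻¹ : ℝ)) : ℂ) * (K i x.1 x.2 * star (K i y.1 y.2)) := by
      intro x y
      have := congrFun (congrFun hV' x) y
      rw [mul_apply] at this
      simp only [conjTranspose_apply, Matrix.smul_apply, smul_eq_mul] at this
      rw [choi_depolarizing, ← Finset.mul_sum]
      simp only [hK, of_apply]
      rw [this, Matrix.smul_apply, smul_eq_mul, ← mul_assoc]
      norm_num
    rw [extend_eq_sum_of_choi hΦK, extend_eq_sum_of_choi hRK]
    refine (relEntropy_sum_smul_le (fun i => hρ.kronecker_one (hU i)) hp
      (q := fun _ => 4⁻¹) (fun _ => by norm_num)).trans (le_of_eq ?_)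
    rw [EReal.coe_eq_coe_iff, hH]
    have : ∀ i, p i * Real.log (p i / 4⁻¹) = p i * (2 * Real.log 2) + p i * Real.log (p i) := by
      intro i
      rcases eq_or_ne (p i) 0 with h0 | h0
      · simp [h0]
      · rw [Real.log_div h0 (by norm_num), Real.log_inv, show (4 : ℝ) = 2 ^ 2 by norm_num,
          Real.log_pow]
        push_cast
        ring
    simp only [this, Finset.sum_add_distrib, ← Finset.sum_mul, hsum]
    ring
  · exact le_iSup_of_le 2 (le_iSup_of_le (maxEntangled (Fin 2))
      (le_iSup_of_le (isDensity_maxEntangled _) le_rfl))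

end QChannel

theorem theorem1
    (Φ : Matrix (Fin 2) (Fin 2) ℂ →ₗ[ℂ] Matrix (Fin 2) (Fin 2) ℂ)
    (hΦ : QChannel.IsChannel Φ) (hunital : Φ 1 = 1) :
    QChannel.channelEntropy Φ = ((QChannel.mapEntropy Φ - Real.log 2 : ℝ) : EReal) ∧
    QChannel.IsDensity (QChannel.maxEntangled (Fin 2)) ∧
    QChannel.channelRelEntropy Φ (QChannel.depolarizing (Fin 2) (Fin 2)) =
      QChannel.relEntropy
        (QChannel.extend (Fin 2) Φ (QChannel.maxEntangled (Fin 2)))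
        (QChannel.extend (Fin 2) (QChannel.depolarizing (Fin 2) (Fin 2))
          (QChannel.maxEntangled (Fin 2))) := by
  obtain ⟨hsup, hmax⟩ := QChannel.channelRelEntropy_depolarizing_qubit hΦ hunital
  refine ⟨?_, QChannel.isDensity_maxEntangled _, hsup⟩
  rw [QChannel.channelEntropy, hsup, hmax, ← EReal.coe_sub, EReal.coe_eq_coe_iff, Fintype.card_fin]
  push_cast
  ring
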